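/- Fix integers $n\ge 2$, $d\ge 1$ and put $k=n-1$. A *dynamic helper selection (DHS) scheme* $A$ assigns to every time $\tau$ and every sequence of failed nodes $F_1,\dots,F_\tau\in\{1,\dots,n\}$ a set $D_\tau(F_1,\dots,F_\tau)$ of $d$ nodes other than $F_\tau$ (the helpers of the newcomer that replaces $F_\tau$). Given $\alpha,\beta\in[0,\infty]$, every finite failure sequence $F_1,\dots,F_T$ yields an *information flow graph*: it has a source $s$, and for each of the $n$ initial storage nodes and each of the $T$ newcomers an input vertex and an output vertex joined by an edge of capacity $\alpha$; there are edges of infinite capacity from $s$ to the input vertices of the initial nodes; for each $\tau\le T$ there are edges of capacity $\beta$ to the input vertex of the $\tau$-th newcomer from the output vertices of the $d$ storage nodes that have index in $D_\tau(F_1,\dots,F_\tau)$ and are active (present in the network) at that time; finally, for each of the $\binom nk$ choices of $k$ of the $n$ nodes there is a data collector vertex $t$, with edges of infinite capacity from the output vertices of the finally active storage nodes with these indices. Let $\mathcal G_A(\alpha,\beta)$ be the collection of these graphs over all finite failure sequences, let $\mathrm{DC}(G)$ be the set of data collectors of $G$, let $\mathrm{mincut}_G(s,t)$ be the minimum capacity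 of a cut separating $s$ from $t$ in $G$, and put $$C_A(\alpha,\beta)=\min_{G\in\mathcal G_A(\alpha,\beta)}\ \min_{t\in \mathrm{DC}(G)}\mathrm{mincut}_G(s,t).$$ *Family scheme.* For $m>d$ nodes numbered $1,\dots,m$, split the nodes in order into $\lfloor m/(m-d)\rfloor$ complete families of $m-d$ consecutive nodes each; the remaining $m \bmod (m-d)$ nodes form the incomplete family. A failed node of a complete family is always repaired from the $d$ nodes outside its family; a failed node of the incomplete family is always repaired from the nodes $1,\dots,d$. *Family-plus scheme.* Partition the $n$ nodes into $B$ groups of arbitrary sizes $n_1,\dots,n_B>d$ (so $n=\sum_b n_b$), number the nodes within each group arbitrarily, and use the family scheme within each group. Let $F^+$ denote this DHS scheme. **Proposition.** Suppose that $n_b \bmod (n_b-d)=0$ for all $b=1,\dots,B$. 1. For all finite $\alpha,\beta\ge 0$ with $\alpha=d\beta$ and every DHS scheme $A$, $$C_{F^+}(\alpha,\beta)=\frac{n\alpha}{2}\ \ge\ C_A(\alpha,\beta).$$ 2. Consequently $F^+$ attains the optimal minimum-bandwidth-regenerating (MBR) point. Precisely, for every file size $\mathcal M\in[0,\infty)$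 the values $\beta_{\mathrm{MBR}}=\min\{\beta: C_{F^+}(\infty,\beta)\ge\mathcal M\}$ and $\alpha_{\mathrm{MBR}}=\min\{\alpha: C_{F^+}(\alpha,\beta_{\mathrm{MBR}})\ge\mathcal M\}$ exist, and $$\beta_{\mathrm{MBR}}=\frac{2\mathcal M}{nd},\qquad \alpha_{\mathrm{MBR}}=d\beta_{\mathrm{MBR}}=\frac{2\mathcal M}{n};$$ moreover every DHS scheme $A$ and all $\alpha,\beta\in[0,\infty]$ with $C_A(\alpha,\beta)\ge\mathcal M$ satisfy $\beta\ge \frac{2\mathcal M}{nd}$, so that the repair bandwidth $d\beta$ is at least $\frac{2\mathcal M}{n}$. -/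

import Mathlib

open scoped NNReal ENNReal

/-! ### Helper selection schemes -/

/-- A dynamic helper selection scheme on the nodes `Fin n`: given the failures `F 0, …, F τ` so far,
the newcomer replacing the latest failed node `F τ` is assigned `d` of the other `n - 1` nodes. -/
structure DHSScheme (n d : ℕ) where
  helpers : (τ : ℕ) → (Fin (τ + 1) → Fin n) → Finset (Fin n)
  card_helpers : ∀ τ F, (helpers τ F).card = d
  failed_notMem : ∀ τ F, F (Fin.last τ) ∉ helpers τ F

/-- The stationary scheme in which a newcomer for node `i` always uses the helper set `D i`. -/
def DHSScheme.stationary {n d : ℕ} (D : Fin n → Finset (Fin n))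
    (hcard : ∀ i, (D i).card = d) (hself : ∀ i, i ∉ D i) : DHSScheme n d where
  helpers τ F := D (F (Fin.last τ))
  card_helpers _ _ := hcard _
  failed_notMem _ _ := hself _

/-! ### Information flow graphs -/

/-- The storage nodes of the information flow graph of a history with `T` failures:
`Sum.inl i` is the initial node `i`, and `Sum.inr τ` is the newcomer created at time `τ`. -/
abbrev StorageNode (n T : ℕ) := Fin n ⊕ Fin T

/-- The index of a storage node, for the failure pattern `F`. -/
def StorageNode.index {n T : ℕ} (F : Fin T → Fin n) : StorageNode n T → Fin n
  | .inl i => i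
  | .inr τ => F τ

/-- The storage node is active after the failures (and repairs) at the times `l < τ`: it has been
created, and the node with its index has not failed since. -/
def StorageNode.IsActive {n T : ℕ} (F : Fin T → Fin n) (τ : ℕ) : StorageNode n T → Prop
  | .inl i => ∀ l : Fin T, (l : ℕ) < τ → F l ≠ i
  | .inr σ => (σ : ℕ) < τ ∧ ∀ l : Fin T, σ < l → (l : ℕ) < τ → F l ≠ F σ

/-- Vertices of an information flow graph: the source, an input and an output vertex for every
storage node, and one data collector for every choice of `k` of the `n` (active) nodes. -/
inductive IFGVertex (n k T : ℕ)
  | source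
  | inp (v : StorageNode n T)
  | out (v : StorageNode n T)
  | collector (S : {S : Finset (Fin n) // S.card = k})
  deriving DecidableEq, Fintype

/-- The helper set used at time `τ` when the failure pattern is `F`. -/
def DHSScheme.helpersAt {n d T : ℕ} (A : DHSScheme n d) (F : Fin T → Fin n) (τ : Fin T) :
    Finset (Fin n) :=
  A.helpers τ (fun l => F (l.castLE τ.isLt))

open Classical in
/-- Edge capacities (`0` if there is no edge) of the information flow graph of the scheme `A` and
the failure pattern `F`. -/
noncomputable def DHSScheme.capacity {n d T : ℕ} (A : DHSScheme n d) (F : Fin T → Fin n)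
    (k : ℕ) (α β : ℝ≥0∞) : IFGVertex n k T → IFGVertex n k T → ℝ≥0∞
  | .source, .inp (.inl _) => ⊤
  | .inp v, .out w => if v = w then α else 0
  | .out v, .inp (.inr τ) =>
      if StorageNode.IsActive F τ v ∧ StorageNode.index F v ∈ A.helpersAt F τ then β else 0
  | .out v, .collector S =>
      if StorageNode.IsActive F T v ∧ StorageNode.index F v ∈ S.1 then ⊤ else 0
  | _, _ => 0

/-- The minimum cut value separating `s` from `t` in a finite directed graph with edge
capacities `c`. -/
noncomputable def minCut {V : Type*} [Fintype V] [DecidableEq V] (c : V → V → ℝ≥0∞) (s t : V) :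
    ℝ≥0∞ :=
  ⨅ (U : Finset V) (_ : s ∈ U ∧ t ∉ U), ∑ u ∈ U, ∑ v ∈ Uᶜ, c u v

/-- All values `minCut_G(s, t)`, where `G` ranges over the information flow graphs of the scheme `A`
(one for every finite failure pattern) and `t` over the data collectors of `G`. -/
def DHSScheme.minCutValues {n d : ℕ} (A : DHSScheme n d) (k : ℕ) (α β : ℝ≥0∞) : Set ℝ≥0∞ :=
  {c | ∃ (T : ℕ) (F : Fin T → Fin n) (S : {S : Finset (Fin n) // S.card = k}),
    c = minCut (A.capacity F k α β) .source (.collector S)}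

/-- The min-cut of the scheme `A`: the minimum over its information flow graphs `G` and over the data
collectors `t` of `G` of `minCut_G(s, t)`. -/
noncomputable def DHSScheme.minCut {n d : ℕ} (A : DHSScheme n d) (k : ℕ) (α β : ℝ≥0∞) : ℝ≥0∞ :=
  sInf (A.minCutValues k α β)

/-- `(α, β)` is the minimum bandwidth regenerating point of the scheme `A` for files of size `M`:
`β` is the least value for which the min-cut is at least `M` with unbounded storage per node, and `α`
is the least storage per node for which the min-cut is at least `M` with this `β`. -/
def DHSScheme.IsMBRPoint {n d : ℕ} (A : DHSScheme n d) (k : ℕ) (M α β : ℝ≥0∞) : Prop :=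
  IsLeast {b : ℝ≥0∞ | M ≤ A.minCut k ⊤ b} β ∧ IsLeast {a : ℝ≥0∞ | M ≤ A.minCut k a β} α

/-! ### The family and family-plus helper selection schemes -/

/-- The helper set of node `i` in the family scheme on `m` nodes `0, …, m - 1`. The family of `j` is
`j / (m - d)`; the first `m / (m - d)` families are complete (they have `m - d` members) and the
remaining `m % (m - d)` nodes form the incomplete family. Members of a complete family use all nodes
outside their family, members of the incomplete family use the first `d` nodes. -/
def familyHelpers (m d : ℕ) (i : Fin m) : Finset (Fin m) :=
  if (i : ℕ) < m / (m - d) * (m - d) then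
    Finset.univ.filter fun j => (j : ℕ) / (m - d) ≠ (i : ℕ) / (m - d)
  else
    Finset.univ.filter fun j => (j : ℕ) < d

theorem familyHelpers_card {m d : ℕ} (h : d < m) (i : Fin m) : (familyHelpers m d i).card = d := by
  have hp : 0 < m - d := by omega
  unfold familyHelpers
  split_ifs with hi
  · have hq : (i : ℕ) / (m - d) < m / (m - d) := by
      rw [Nat.div_lt_iff_lt_mul hp]; exact hi
    set q := (i : ℕ) / (m - d) with hqdef
    have hle : (q + 1) * (m - d) ≤ m :=
      (Nat.mul_le_mul_right _ hq).trans (Nat.div_mul_le_self _ _)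
    have hbij : (Finset.univ.filter fun j : Fin m => (j : ℕ) / (m - d) = q).card = m - d := by
      have : (Finset.univ.filter fun j : Fin m => (j : ℕ) / (m - d) = q).map Fin.valEmbedding
          = Finset.Ico (q * (m - d)) ((q + 1) * (m - d)) := by
        ext x
        simp only [Finset.mem_map, Finset.mem_filter, Finset.mem_univ, true_and,
          Fin.valEmbedding_apply, Finset.mem_Ico]
        constructor
        · rintro ⟨j, hj, rfl⟩
          rw [← hj]
          exact ⟨Nat.div_mul_le_self _ _, by rw [← Nat.div_lt_iff_lt_mul hp]; omega⟩
        · rintro ⟨h1, h2⟩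
          refine ⟨⟨x, h2.trans_le hle⟩, ?_, rfl⟩
          exact Nat.div_eq_of_lt_le h1 h2
      rw [← Finset.card_map Fin.valEmbedding, this, Nat.card_Ico, Nat.succ_mul]
      omega
    have := Finset.card_filter_add_card_filter_not (s := (Finset.univ : Finset (Fin m)))
      (fun j : Fin m => (j : ℕ) / (m - d) = q)
    rw [hbij, Finset.card_univ, Fintype.card_fin] at this
    change (Finset.univ.filter fun j : Fin m => ¬ (j : ℕ) / (m - d) = q).card = d
    omega
  · have : (Finset.univ.filter fun j : Fin m => (j : ℕ) < d).map Fin.valEmbedding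
        = Finset.range d := by
      ext x
      simp only [Finset.mem_map, Finset.mem_filter, Finset.mem_univ, true_and,
        Fin.valEmbedding_apply, Finset.mem_range]
      constructor
      · rintro ⟨j, hj, rfl⟩; exact hj
      · intro hx; exact ⟨⟨x, hx.trans h⟩, hx, rfl⟩
    rw [← Finset.card_map Fin.valEmbedding, this, Finset.card_range]

theorem notMem_familyHelpers {m d : ℕ} (h : d < m) (i : Fin m) : i ∉ familyHelpers m d i := by
  have hp : 0 < m - d := by omega
  unfold familyHelpers
  split_ifs with hi
  · simp
  · have h1 := Nat.div_add_mod' m (m - d)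
    have h2 := Nat.mod_lt m hp
    simp only [Finset.mem_filter, Finset.mem_univ, true_and]
    omega

/-- The family-plus scheme for a division of the `n` nodes into `B` groups, the `b`-th of size
`m b > d`: the bijection `e` sends a node to its group and to its position in that group, and the
family scheme is used within each group. -/
def familyPlus {n d B : ℕ} (m : Fin B → ℕ) (hm : ∀ b, d < m b)
    (e : Fin n ≃ (b : Fin B) × Fin (m b)) : DHSScheme n d :=
  DHSScheme.stationary
    (fun i => (familyHelpers (m (e i).1) d (e i).2).map
      ((Function.Embedding.sigmaMk (e i).1).trans e.symm.toEmbedding))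
    (fun i => by rw [Finset.card_map, familyHelpers_card (hm _)])
    (fun i => by
      intro hi
      obtain ⟨j, hj, hji⟩ := Finset.mem_map.1 hi
      have h1 : (⟨(e i).1, j⟩ : (b : Fin B) × Fin (m b)) = e i := by
        rw [← e.symm_apply_eq]; exact hji
      have h2 : j = (e i).2 := by
        have h3 : (⟨(e i).1, j⟩ : (b : Fin B) × Fin (m b)) = ⟨(e i).1, (e i).2⟩ := h1
        exact eq_of_heq (Sigma.mk.inj h3).2
      exact notMem_familyHelpers (hm _) _ (h2 ▸ hj))

/-! ### Active storage nodes -/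

section Active

variable {n T : ℕ} {F : Fin T → Fin n}

/-! Lower bound: when every group splits into complete families, "is a helper of" is a symmetric
relation: same group, different family. So the helpers form a `d`-regular graph without loops. For a
set `X` of nodes, `helperWeight` is twice the number of edges meeting `X`. Fix a cut and let `X` be
the indices of active nodes whose output lies on the sink side. As time runs, a newcomer whose index
joins `X` costs the cut at least `β` per helper outside `X`, which is exactly half the growth of the
weight times `β`; an index leaving `X` only lowers the weight. A finite cut ends with `X` containing
all nodes but one, and those meet all `n d / 2` edges (`DHSScheme.helperWeight_le_cut`,
`DHSScheme.le_minCut_stationary`).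

Upper bound, for any scheme: draw an arc to each latest newcomer from each of its helpers that is
itself a latest newcomer. While there are fewer than `n d / 2` arcs, some node meets fewer than `d`
of them; failing it gains `d` arcs and loses fewer (`DHSScheme.exists_many_arcs`). Once `n d / 2`
arcs exist, omit a node of at most average degree. The others keep so many arcs among themselves
that cutting all remaining helper edges costs at most `n d β / 2` (`DHSScheme.exists_minCut_le`).
Cutting the storage edge of the earliest of these newcomers instead of its `d` helper edges trades
`d β` for `α`, which determines the optimal `α` at the MBR point. -/

theorem StorageNode.IsActive.eq_of_index_eq {τ : ℕ} {v w : StorageNode n T}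
    (hv : StorageNode.IsActive F τ v) (hw : StorageNode.IsActive F τ w)
    (h : StorageNode.index F v = StorageNode.index F w) : v = w := by
  rcases v with i | σ <;> rcases w with j | ρ <;>
    simp only [StorageNode.IsActive, StorageNode.index] at hv hw h
  · rw [h]
  · exact absurd h.symm (hv ρ hw.1)
  · exact absurd h (hw σ hv.1)
  · rcases lt_trichotomy σ ρ with hlt | heq | hlt
    · exact absurd h.symm (hv.2 ρ hlt hw.1)
    · rw [heq]
    · exact absurd h (hw.2 σ hlt hv.1)

theorem StorageNode.exists_isActive (F : Fin T → Fin n) (τ : ℕ) (i : Fin n) :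
    ∃ v, StorageNode.IsActive F τ v ∧ StorageNode.index F v = i := by
  classical
  by_cases h : ∃ l : Fin T, (l : ℕ) < τ ∧ F l = i
  · let s := Finset.univ.filter fun l : Fin T => (l : ℕ) < τ ∧ F l = i
    have hs : s.Nonempty := h.imp fun l hl => by simpa [s] using hl
    have hmem := s.max'_mem hs
    simp only [s, Finset.mem_filter, Finset.mem_univ, true_and] at hmem
    refine ⟨.inr (s.max' hs), ⟨hmem.1, fun l hl hlτ hF => ?_⟩, hmem.2⟩
    exact absurd (s.le_max' l (by simp [s, hlτ, hF, hmem.2])) (not_le.2 hl)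
  · push Not at h
    exact ⟨.inl i, h, rfl⟩

theorem StorageNode.IsActive.of_succ {τ : Fin T} {v : StorageNode n T}
    (hv : StorageNode.IsActive F (τ + 1) v) :
    v = .inr τ ∨ StorageNode.IsActive F τ v := by
  rcases v with i | σ <;> simp only [StorageNode.IsActive] at hv ⊢
  · exact Or.inr fun l hl => hv l (by omega)
  · rcases eq_or_ne σ τ with rfl | hne
    · exact Or.inl rfl
    · have : (σ : ℕ) ≠ τ := fun h => hne (Fin.ext h)
      exact Or.inr ⟨by omega, fun l hl hlτ => hv.2 l hl (by omega)⟩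

end Active

/-! ### Lower bound for stationary schemes with symmetric helper sets -/

section Weight

variable {V : Type*} [DecidableEq V]

/-- `d |X|` plus the number of pairs consisting of an element of `X` and one of its helpers
outside `X`. -/
def helperWeight (D : V → Finset V) (d : ℕ) (X : Finset V) : ℕ :=
  d * X.card + ∑ i ∈ X, (D i \ X).card

/-- The new edges are those from `i` to helpers outside `X`, each counted twice. In the formula, `i`
brings `d` plus its helpers outside `X`, while by symmetry each neighbour inside `X` loses `i` as an
outside helper. -/
theorem helperWeight_insert {D : V → Finset V} {d : ℕ} (hcard : ∀ i, (D i).card = d)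
    (hself : ∀ i, i ∉ D i) (hsymm : ∀ i j, j ∈ D i → i ∈ D j) {X : Finset V} {i : V}
    (hi : i ∉ X) :
    helperWeight D d (insert i X) = helperWeight D d X + 2 * (D i \ X).card := by
  have h1 : D i \ insert i X = D i \ X := by
    ext j; simp only [Finset.mem_sdiff, Finset.mem_insert, not_or]
    exact ⟨fun h => ⟨h.1, h.2.2⟩, fun h => ⟨h.1, fun hj => hself i (hj ▸ h.1), h.2⟩⟩
  have h2 : ∑ j ∈ X, (D j \ insert i X).card + (D i ∩ X).card = ∑ j ∈ X, (D j \ X).card := by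
    have h3 : D i ∩ X = X.filter fun j => i ∈ D j := by
      ext j; simp only [Finset.mem_inter, Finset.mem_filter]
      exact ⟨fun h => ⟨h.2, hsymm _ _ h.1⟩, fun h => ⟨hsymm _ _ h.2, h.1⟩⟩
    rw [h3, Finset.card_filter, ← Finset.sum_add_distrib]
    refine Finset.sum_congr rfl fun j _ => ?_
    rw [Finset.sdiff_insert]
    split_ifs with hij
    · exact Finset.card_erase_add_one (Finset.mem_sdiff.2 ⟨hij, hi⟩)
    · rw [Finset.erase_eq_of_notMem fun h => hij (Finset.mem_sdiff.1 h).1, add_zero]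
  have h4 := Finset.card_sdiff_add_card_inter (D i) X
  rw [hcard] at h4
  simp only [helperWeight, Finset.card_insert_of_notMem hi, Finset.sum_insert hi, h1]
  rw [← h2]
  linarith [Nat.mul_succ d X.card]

theorem helperWeight_mono {D : V → Finset V} {d : ℕ} (hcard : ∀ i, (D i).card = d)
    (hself : ∀ i, i ∉ D i) (hsymm : ∀ i j, j ∈ D i → i ∈ D j) : Monotone (helperWeight D d) :=
  Finset.monotone_iff_forall_le_insert.2 fun X i hi => by
    rw [helperWeight_insert hcard hself hsymm hi]; exact Nat.le_add_right _ _

theorem helperWeight_univ_erase [Fintype V] {D : V → Finset V} {d : ℕ}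
    (hcard : ∀ i, (D i).card = d) (hself : ∀ i, i ∉ D i) (hsymm : ∀ i j, j ∈ D i → i ∈ D j)
    (w : V) : helperWeight D d (Finset.univ.erase w) = Fintype.card V * d := by
  have h := helperWeight_insert hcard hself hsymm (Finset.notMem_erase w Finset.univ)
  have h1 : D w \ Finset.univ.erase w = ∅ := by
    ext j; simpa using fun (hj : j ∈ D w) (e : j = w) => hself w (e ▸ hj)
  rw [Finset.insert_erase (Finset.mem_univ w), h1] at h
  simp only [Finset.card_empty, mul_zero, add_zero] at h
  rw [← h, helperWeight, Finset.card_univ]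
  simp [mul_comm]

end Weight

/-! ### Charging the weight to a cut. -/

section Lower

variable {n d : ℕ}

/-- Indices of the nodes active at time `τ` whose output vertex lies outside `U`. -/
def cutIndices {k T : ℕ} (F : Fin T → Fin n) (U : Finset (IFGVertex n k T)) (τ : ℕ) :
    Set (Fin n) :=
  {i | ∃ v, StorageNode.IsActive F τ v ∧ StorageNode.index F v = i ∧ IFGVertex.out v ∉ U}

open Classical in
/-- The capacity of the cut edges that enter the input or else the output vertex of `v`. -/
noncomputable def DHSScheme.nodeCost {k T : ℕ} (A : DHSScheme n d) (F : Fin T → Fin n)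
    (α β : ℝ≥0∞) (U : Finset (IFGVertex n k T)) (v : StorageNode n T) : ℝ≥0∞ :=
  if IFGVertex.out v ∈ U then 0
  else if IFGVertex.inp v ∈ U then α
  else ∑ u ∈ U, A.capacity F k α β u (.inp v)

/-- Each storage node is charged only for edges entering one sink-side vertex `g v` of its own;
since `g` is injective there, no cut edge is counted twice. -/
theorem DHSScheme.sum_nodeCost_le {k T : ℕ} (A : DHSScheme n d) (F : Fin T → Fin n)
    (α β : ℝ≥0∞) (U : Finset (IFGVertex n k T)) :
    ∑ v, A.nodeCost F α β U v ≤ ∑ u ∈ U, ∑ v ∈ Uᶜ, A.capacity F k α β u v := by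
  classical
  rw [Finset.sum_comm]
  let g : StorageNode n T → IFGVertex n k T := fun v =>
    if IFGVertex.inp v ∈ U then .out v else .inp v
  let X := Finset.univ.filter fun v : StorageNode n T => (IFGVertex.out v : IFGVertex n k T) ∉ U
  have hX : ∑ v, A.nodeCost F α β U v = ∑ v ∈ X, A.nodeCost F α β U v := by
    rw [Finset.sum_filter]
    refine Finset.sum_congr rfl fun v _ => ?_
    unfold DHSScheme.nodeCost
    split_ifs <;> simp_all
  have hg : Set.InjOn g X := by
    intro v _ w _ h
    simp only [g] at h
    split_ifs at h <;> simpa using h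
  have hsub : X.image g ⊆ Uᶜ := by
    intro u hu
    obtain ⟨v, hv, rfl⟩ := Finset.mem_image.1 hu
    simp only [X, Finset.mem_filter, Finset.mem_univ, true_and] at hv
    simp only [g, Finset.mem_compl]
    split_ifs <;> assumption
  rw [hX]
  refine le_trans ?_ (Finset.sum_le_sum_of_subset hsub)
  rw [Finset.sum_image hg]
  refine Finset.sum_le_sum fun v hv => ?_
  simp only [X, Finset.mem_filter, Finset.mem_univ, true_and] at hv
  simp only [DHSScheme.nodeCost, if_neg hv, g]
  split_ifs with h
  · have h1 : A.capacity F k α β (.inp v) (.out v) = α := by simp [DHSScheme.capacity]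
    exact h1.ge.trans (Finset.single_le_sum (f := fun u => A.capacity F k α β u (.out v))
      (fun _ _ => zero_le) h)
  · exact le_rfl

theorem DHSScheme.le_nodeCost_inl {k T : ℕ} (A : DHSScheme n d) (F : Fin T → Fin n)
    (α β : ℝ≥0∞) {U : Finset (IFGVertex n k T)} (hs : .source ∈ U) {i : Fin n}
    (hi : IFGVertex.out (.inl i) ∉ U) : α ≤ A.nodeCost F α β U (.inl i) := by
  rw [DHSScheme.nodeCost, if_neg hi]
  split_ifs
  · exact le_rfl
  · exact le_top.trans (Finset.single_le_sum
      (f := fun u => A.capacity F k α β u (.inp (.inl i))) (fun _ _ => zero_le) hs)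

theorem DHSScheme.le_nodeCost_inr {k T : ℕ} (A : DHSScheme n d) (F : Fin T → Fin n)
    (β : ℝ≥0∞) {U : Finset (IFGVertex n k T)} {τ : Fin T}
    (hτ : IFGVertex.out (.inr τ) ∉ U) {X : Finset (Fin n)} (hX : ↑X = cutIndices F U τ) :
    ((A.helpersAt F τ \ X).card : ℝ≥0∞) * β ≤ A.nodeCost F (d * β) β U (.inr τ) := by
  classical
  rw [DHSScheme.nodeCost, if_neg hτ]
  split_ifs
  -- Here the storage edge is cut, and its capacity `d * β` pays for all `d` helpers at once.
  · gcongr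
    exact (Finset.card_le_card Finset.sdiff_subset).trans (A.card_helpers _ _).le
  · choose a ha hai using StorageNode.exists_isActive F τ
    have hsub : (A.helpersAt F τ \ X).image (fun i => (.out (a i) : IFGVertex n k T)) ⊆ U := by
      intro u hu
      obtain ⟨i, hi, rfl⟩ := Finset.mem_image.1 hu
      by_contra hU
      refine (Finset.mem_sdiff.1 hi).2 ?_
      rw [← Finset.mem_coe, hX]
      exact ⟨a i, ha i, hai i, hU⟩
    refine le_trans ?_ (Finset.sum_le_sum_of_subset hsub)
    rw [Finset.sum_image fun i _ j _ h => by
      rw [← hai i, ← hai j, IFGVertex.out.inj h], ← nsmul_eq_mul]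
    refine Finset.card_nsmul_le_sum _ _ _ fun i hi => ?_
    simp [DHSScheme.capacity, ha, hai, (Finset.mem_sdiff.1 hi).1]

theorem DHSScheme.helperWeight_le_cut {D : Fin n → Finset (Fin n)}
    (hcard : ∀ i, (D i).card = d) (hself : ∀ i, i ∉ D i) (hsymm : ∀ i j, j ∈ D i → i ∈ D j)
    {k T : ℕ} (F : Fin T → Fin n) (β : ℝ≥0∞) {U : Finset (IFGVertex n k T)} (hs : .source ∈ U)
    {X : Finset (Fin n)} (hX : ↑X ⊆ cutIndices F U T) :
    (helperWeight D d X : ℝ≥0∞) * β ≤ 2 * ∑ u ∈ U, ∑ v ∈ Uᶜ,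
      (DHSScheme.stationary D hcard hself).capacity F k (d * β) β u v := by
  classical
  set A := DHSScheme.stationary D hcard hself
  set c := A.nodeCost F (d * β) β U
  -- Induction on time, charging only the initial nodes and the newcomers created before `t`.
  have key : ∀ t ≤ T, ∀ X : Finset (Fin n), ↑X = cutIndices F U t →
      (helperWeight D d X : ℝ≥0∞) * β ≤
        2 * (∑ i, c (.inl i) + ∑ τ ∈ {l : Fin T | (l : ℕ) < t}, c (.inr τ)) := by
    intro t
    induction t with
    | zero =>
      intro _ X hX
      have h1 : helperWeight D d X ≤ 2 * (d * X.card) := by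
        have : ∑ i ∈ X, (D i \ X).card ≤ X.card * d := Finset.sum_le_card_nsmul _ _ _
          fun i _ => (Finset.card_le_card Finset.sdiff_subset).trans (hcard i).le
        rw [helperWeight]; linarith [mul_comm X.card d]
      calc (helperWeight D d X : ℝ≥0∞) * β ≤ ((2 * (d * X.card) : ℕ) : ℝ≥0∞) * β := by gcongr
        _ = 2 * (X.card * (d * β)) := by push_cast; ring
        _ ≤ 2 * ∑ i ∈ X, c (.inl i) := by
          gcongr
          rw [← nsmul_eq_mul]
          refine Finset.card_nsmul_le_sum _ _ _ fun i hi => ?_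
          rw [← Finset.mem_coe, hX] at hi
          obtain ⟨v, hv, hvi, hvU⟩ := hi
          rcases v with j | τ
          · obtain rfl : j = i := hvi
            exact A.le_nodeCost_inl F _ _ hs hvU
          · exact absurd hv.1 (Nat.not_lt_zero _)
        _ ≤ _ := by
          gcongr
          exact (Finset.sum_le_sum_of_subset (Finset.subset_univ X)).trans le_self_add
    | succ t ih =>
      intro ht X hX
      let τ : Fin T := ⟨t, ht⟩
      let Y : Finset (Fin n) := Finset.univ.filter (· ∈ cutIndices F U t)
      have hY : ↑Y = cutIndices F U t := by ext; simp [Y]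
      have hf : (Finset.univ.filter fun σ : Fin T => (σ : ℕ) < t + 1) =
          insert τ (Finset.univ.filter fun σ : Fin T => (σ : ℕ) < t) := by
        ext σ; simp [τ, Fin.ext_iff]; omega
      have hsum : ∑ σ ∈ {l : Fin T | (l : ℕ) < t + 1}, c (.inr σ) =
          c (.inr τ) + ∑ σ ∈ {l : Fin T | (l : ℕ) < t}, c (.inr σ) := by
        rw [hf, Finset.sum_insert (by simp [τ])]
      have ih' := ih (by omega) Y hY
      have hstep : ∀ i ∈ X, i ∈ Y ∨ i = F τ ∧ IFGVertex.out (.inr τ) ∉ U := by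
        intro i hi
        rw [← Finset.mem_coe, hX] at hi
        obtain ⟨v, hv, hvi, hvU⟩ := hi
        rcases StorageNode.IsActive.of_succ (τ := τ) hv with rfl | hv'
        · exact Or.inr ⟨hvi.symm, hvU⟩
        · left; rw [← Finset.mem_coe, hY]; exact ⟨v, hv', hvi, hvU⟩
      have hmono := helperWeight_mono hcard hself hsymm
      -- If no index joins, monotonicity of the weight suffices. Otherwise the only index that can
      -- join is the one that just failed.
      by_cases hXY : X ⊆ Y
      · calc (helperWeight D d X : ℝ≥0∞) * β ≤ (helperWeight D d Y : ℝ≥0∞) * β := by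
              gcongr; exact hmono hXY
          _ ≤ _ := ih'.trans (by rw [hsum]; gcongr; exact le_add_self)
      · obtain ⟨i, hi, hiY⟩ := Finset.not_subset.1 hXY
        obtain ⟨rfl, hU⟩ := (hstep i hi).resolve_left hiY
        have hsub : X ⊆ insert (F τ) Y := fun j hj => Finset.mem_insert.2
          ((hstep j hj).symm.imp And.left id)
        calc (helperWeight D d X : ℝ≥0∞) * β
            ≤ (helperWeight D d (insert (F τ) Y) : ℝ≥0∞) * β := by gcongr; exact hmono hsub
          _ = helperWeight D d Y * β + 2 * ((D (F τ) \ Y).card * β) := by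
            rw [helperWeight_insert hcard hself hsymm hiY]; push_cast; ring
          _ ≤ 2 * (∑ i, c (.inl i) + ∑ σ ∈ {l : Fin T | (l : ℕ) < t}, c (.inr σ)) +
              2 * c (.inr τ) := by
            gcongr
            exact A.le_nodeCost_inr F β hU hY
          _ = _ := by rw [hsum]; ring
  let Y : Finset (Fin n) := Finset.univ.filter (· ∈ cutIndices F U T)
  have hY : ↑Y = cutIndices F U T := by ext; simp [Y]
  have hXY : X ⊆ Y := by rw [← Finset.coe_subset, hY]; exact hX
  calc (helperWeight D d X : ℝ≥0∞) * β ≤ (helperWeight D d Y : ℝ≥0∞) * β := by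
        gcongr; exact helperWeight_mono hcard hself hsymm hXY
    _ ≤ _ := key T le_rfl Y hY
    _ = 2 * ∑ v, c v := by simp [Fintype.sum_sum_type]
    _ ≤ _ := by gcongr; exact A.sum_nodeCost_le F _ _ U

theorem DHSScheme.le_minCut_stationary {D : Fin n → Finset (Fin n)}
    (hcard : ∀ i, (D i).card = d) (hself : ∀ i, i ∉ D i) (hsymm : ∀ i j, j ∈ D i → i ∈ D j)
    (hn : 2 ≤ n) {T : ℕ} (F : Fin T → Fin n) (β : ℝ≥0∞)
    (S : {S : Finset (Fin n) // S.card = n - 1}) :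
    ((n * d : ℕ) : ℝ≥0∞) * β ≤ 2 * _root_.minCut
      ((DHSScheme.stationary D hcard hself).capacity F (n - 1) (d * β) β)
      .source (.collector S) := by
  classical
  obtain ⟨w, hw⟩ : ∃ w, S.1 = Finset.univ.erase w := by
    have h1 : S.1ᶜ.card = 1 := by
      rw [Finset.card_compl, S.2, Fintype.card_fin]; omega
    obtain ⟨w, hw⟩ := Finset.card_eq_one.1 h1
    exact ⟨w, by rw [← compl_compl S.1, hw]; ext; simp⟩
  rw [_root_.minCut, ENNReal.mul_iInf_of_ne two_ne_zero ENNReal.ofNat_ne_top]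
  refine le_iInf fun U => ?_
  rw [ENNReal.mul_iInf_of_ne two_ne_zero ENNReal.ofNat_ne_top]
  refine le_iInf fun hU => ?_
  -- If some node read by the collector has its output on the source side, an edge of infinite
  -- capacity is cut.
  by_cases hS : ↑S.1 ⊆ cutIndices F U T
  · have h := DHSScheme.helperWeight_le_cut hcard hself hsymm F β hU.1 hS
    rwa [hw, helperWeight_univ_erase hcard hself hsymm, Fintype.card_fin] at h
  · obtain ⟨i, hi, hiU⟩ := Set.not_subset.1 hS
    obtain ⟨v, hv, rfl⟩ := StorageNode.exists_isActive F T i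
    have hvU : IFGVertex.out v ∈ U := by
      by_contra h; exact hiU ⟨v, hv, rfl, h⟩
    set c := (DHSScheme.stationary D hcard hself).capacity F (n - 1) (d * β) β
    have h1 : c (.out v) (.collector S) = ⊤ := by
      simp only [c, DHSScheme.capacity]; rw [if_pos ⟨hv, hi⟩]
    have h2 : (⊤ : ℝ≥0∞) ≤ ∑ u ∈ U, ∑ v ∈ Uᶜ, c u v :=
      h1.ge.trans ((Finset.single_le_sum (f := fun v' => c (.out v) v') (fun _ _ => zero_le)
        (Finset.mem_compl.2 hU.2)).trans
        (Finset.single_le_sum (f := fun u => ∑ v ∈ Uᶜ, c u v) (fun _ _ => zero_le) hvU))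
    rw [top_le_iff.1 h2, ENNReal.mul_top two_ne_zero]
    exact le_top

end Lower

/-! ### Upper bound for arbitrary schemes -/

section Digraph

variable {V : Type*} [Fintype V] [DecidableEq V]

/-- Total degrees sum to twice the number of arcs, so some vertex has at most the average; without
loops, deleting it loses exactly its degree in arcs. -/
theorem exists_small_degree [Nonempty V] (R : V → V → Prop) [DecidableRel R]
    (hR : ∀ x, ¬ R x x) :
    ∃ x, Fintype.card V * ∑ j, (Finset.univ.filter fun i => R i j).card ≤
      Fintype.card V * ∑ j ∈ Finset.univ.erase x, (Finset.univ.filter fun i => i ≠ x ∧ R i j).card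
        + 2 * ∑ j, (Finset.univ.filter fun i => R i j).card := by
  set E := ∑ j, (Finset.univ.filter fun i => R i j).card with hE
  let deg : V → ℕ := fun x =>
    (Finset.univ.filter fun i => R i x).card + (Finset.univ.filter fun j => R x j).card
  have hdeg : ∑ x, deg x = 2 * E := by
    have h1 : ∑ x, (Finset.univ.filter fun j => R x j).card = E := by
      simp only [hE, Finset.card_filter]; exact Finset.sum_comm
    rw [Finset.sum_add_distrib, h1, ← hE]; ring
  obtain ⟨x, -, hx⟩ := Finset.exists_le_of_sum_le (s := Finset.univ)
    (f := fun x => Fintype.card V * deg x) (g := fun _ => 2 * E) Finset.univ_nonempty (by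
      rw [← Finset.mul_sum, hdeg, Finset.sum_const, Finset.card_univ, smul_eq_mul])
  refine ⟨x, ?_⟩
  have h2 : E = ∑ j ∈ Finset.univ.erase x, (Finset.univ.filter fun i => i ≠ x ∧ R i j).card
      + deg x := by
    have h3 : ∀ j, (Finset.univ.filter fun i => R i j).card =
        (Finset.univ.filter fun i => i ≠ x ∧ R i j).card + if R x j then 1 else 0 := by
      intro j
      rw [← Finset.card_filter_add_card_filter_not (s := Finset.univ.filter fun i => R i j)
        (fun i => i ≠ x), Finset.filter_filter, Finset.filter_filter]
      congr 1
      · simp only [and_comm]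
      · split_ifs with h
        · rw [Finset.card_eq_one]
          exact ⟨x, by ext i; simp; rintro rfl; exact h⟩
        · rw [Finset.card_eq_zero]
          ext i; simp; rintro h1 rfl; exact h h1
    have h4 : ∑ j ∈ Finset.univ.erase x, (if R x j then 1 else 0) =
        (Finset.univ.filter fun j => R x j).card := by
      rw [Finset.card_filter, ← Finset.add_sum_erase _ _ (Finset.mem_univ x), if_neg (hR x),
        zero_add]
    rw [hE, ← Finset.add_sum_erase _ _ (Finset.mem_univ x),
      Finset.sum_congr rfl fun j _ => h3 j, Finset.sum_add_distrib, h4]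
    simp only [deg]; ring
  generalize ∑ j ∈ Finset.univ.erase x, (Finset.univ.filter fun i => i ≠ x ∧ R i j).card = E' at *
  calc Fintype.card V * E = Fintype.card V * E' + Fintype.card V * deg x := by
        rw [← mul_add, ← h2]
    _ ≤ _ := Nat.add_le_add_left hx _

end Digraph

/-! ### Failure sequences with many arcs and the resulting cuts. -/

section Upper

variable {n d : ℕ}

/-- During the failures `f 0, …, f (T - 1)` every node fails, node `i` for the last time at
`last i`. -/
structure IsLastFailure (T : ℕ) (f : ℕ → Fin n) (last : Fin n → ℕ) : Prop where
  lt : ∀ i, last i < T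
  index : ∀ i, f (last i) = i
  ne_of_lt : ∀ i l, last i < l → l < T → f l ≠ i

/-- The helper set used at time `τ` for the failure sequence `f`. -/
def DHSScheme.seqHelpers (A : DHSScheme n d) (f : ℕ → Fin n) (τ : ℕ) : Finset (Fin n) :=
  A.helpers τ fun l => f l

/-- The latest newcomer for `i` precedes that for `j` and is one of its helpers. -/
def DHSScheme.Arc (A : DHSScheme n d) (f : ℕ → Fin n) (last : Fin n → ℕ) (i j : Fin n) : Prop :=
  last i < last j ∧ i ∈ A.seqHelpers f (last j)

instance (A : DHSScheme n d) (f : ℕ → Fin n) (last : Fin n → ℕ) : DecidableRel (A.Arc f last) :=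
  fun _ _ => inferInstanceAs (Decidable (_ ∧ _))

theorem DHSScheme.not_arc_self (A : DHSScheme n d) (f : ℕ → Fin n) (last : Fin n → ℕ)
    (i : Fin n) : ¬ A.Arc f last i i := fun h => lt_irrefl _ h.1

theorem IsLastFailure.exists_initial (n : ℕ) (hn : 0 < n) :
    ∃ (T : ℕ) (f : ℕ → Fin n) (last : Fin n → ℕ), IsLastFailure T f last := by
  refine ⟨n, fun l => ⟨l % n, Nat.mod_lt _ hn⟩, fun i => i, fun i => i.2, fun i => ?_,
    fun i l hl hlT h => ?_⟩
  · exact Fin.ext (Nat.mod_eq_of_lt i.2)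
  · have := congrArg Fin.val h
    simp only [Nat.mod_eq_of_lt hlT] at this
    omega

theorem IsLastFailure.update {T : ℕ} {f : ℕ → Fin n} {last : Fin n → ℕ}
    (h : IsLastFailure T f last) (x : Fin n) :
    IsLastFailure (T + 1) (Function.update f T x) (Function.update last x T) where
  lt i := by
    rcases eq_or_ne i x with rfl | hi
    · simp
    · rw [Function.update_of_ne hi]; exact (h.lt i).trans (Nat.lt_succ_self _)
  index i := by
    rcases eq_or_ne i x with rfl | hi
    · simp
    · rw [Function.update_of_ne hi, Function.update_of_ne (h.lt i).ne, h.index]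
  ne_of_lt i l hl hlT := by
    rcases eq_or_ne i x with rfl | hi
    · rw [Function.update_self] at hl; omega
    · rw [Function.update_of_ne hi] at hl
      rcases eq_or_ne l T with rfl | hl'
      · rw [Function.update_self]; exact hi.symm
      · rw [Function.update_of_ne hl']; exact h.ne_of_lt i l hl (by omega)

theorem DHSScheme.seqHelpers_update (A : DHSScheme n d) (f : ℕ → Fin n) {T τ : ℕ} (h : τ < T)
    (x : Fin n) : A.seqHelpers (Function.update f T x) τ = A.seqHelpers f τ := by
  unfold DHSScheme.seqHelpers
  congr 1
  funext l
  exact Function.update_of_ne (by omega) _ _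

/-- Fail a vertex of at most average degree, hence of degree below `d`. Every node has already
failed, so all `d` helpers of the new newcomer are latest newcomers and give arcs; arcs avoiding the
vertex survive. -/
theorem DHSScheme.exists_more_arcs (A : DHSScheme n d) (hn : 0 < n) {T : ℕ} {f : ℕ → Fin n}
    {last : Fin n → ℕ} (h : IsLastFailure T f last)
    (hlt : 2 * ∑ j, (Finset.univ.filter fun i => A.Arc f last i j).card < n * d) :
    ∃ (f' : ℕ → Fin n) (last' : Fin n → ℕ), IsLastFailure (T + 1) f' last' ∧
      ∑ j, (Finset.univ.filter fun i => A.Arc f last i j).card <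
        ∑ j, (Finset.univ.filter fun i => A.Arc f' last' i j).card := by
  have : Nonempty (Fin n) := ⟨⟨0, hn⟩⟩
  obtain ⟨x, hx⟩ := exists_small_degree (A.Arc f last) (A.not_arc_self f last)
  refine ⟨_, _, h.update x, ?_⟩
  rw [Fintype.card_fin] at hx
  set E := ∑ j, (Finset.univ.filter fun i => A.Arc f last i j).card
  set f' := Function.update f T x
  set last' := Function.update last x T
  have hT : last' x = T := Function.update_self ..
  have hx' : x ∉ A.seqHelpers f' T := by
    have := A.failed_notMem T fun l => f' l
    rwa [show f' (Fin.last T : Fin (T + 1)) = x from Function.update_self ..] at this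
  have h1 : d ≤ (Finset.univ.filter fun i => A.Arc f' last' i x).card := by
    refine (A.card_helpers T fun l => f' l).ge.trans (Finset.card_le_card fun i hi => ?_)
    have hi' : i ≠ x := fun e => hx' (e ▸ hi)
    refine Finset.mem_filter.2 ⟨Finset.mem_univ _, ?_, ?_⟩
    · rw [hT, show last' i = last i from Function.update_of_ne hi' ..]; exact h.lt i
    · rw [hT]; exact hi
  have h2 : ∑ j ∈ Finset.univ.erase x,
      (Finset.univ.filter fun i => i ≠ x ∧ A.Arc f last i j).card ≤
      ∑ j ∈ Finset.univ.erase x, (Finset.univ.filter fun i => A.Arc f' last' i j).card := by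
    refine Finset.sum_le_sum fun j hj => Finset.card_le_card fun i hi => ?_
    obtain ⟨hix, hi1, hi2⟩ := (Finset.mem_filter.1 hi).2
    have hj' : last' j = last j := Function.update_of_ne (Finset.ne_of_mem_erase hj) ..
    refine Finset.mem_filter.2 ⟨Finset.mem_univ _, ?_, ?_⟩
    · rw [hj', show last' i = last i from Function.update_of_ne hix ..]; exact hi1
    · rw [hj', A.seqHelpers_update f (h.lt j)]; exact hi2
  rw [← Finset.add_sum_erase _ _ (Finset.mem_univ x)]
  refine lt_of_lt_of_le ?_ (add_le_add h1 h2)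
  refine Nat.lt_of_mul_lt_mul_left (a := n) ?_
  rw [mul_add]
  omega

theorem DHSScheme.exists_many_arcs (A : DHSScheme n d) (hn : 0 < n) :
    ∃ (T : ℕ) (f : ℕ → Fin n) (last : Fin n → ℕ), IsLastFailure T f last ∧
      n * d ≤ 2 * ∑ j, (Finset.univ.filter fun i => A.Arc f last i j).card := by
  by_contra! hcon
  have key : ∀ N, ∃ (T : ℕ) (f : ℕ → Fin n) (last : Fin n → ℕ), IsLastFailure T f last ∧
      N ≤ ∑ j, (Finset.univ.filter fun i => A.Arc f last i j).card := by
    intro N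
    induction N with
    | zero =>
      obtain ⟨T, f, last, h⟩ := IsLastFailure.exists_initial n hn
      exact ⟨T, f, last, h, Nat.zero_le _⟩
    | succ N ih =>
      obtain ⟨T, f, last, h, hN⟩ := ih
      obtain ⟨f', last', h', hlt⟩ := A.exists_more_arcs hn h (hcon T f last h)
      exact ⟨T + 1, f', last', h', by omega⟩
  obtain ⟨T, f, last, h, hN⟩ := key (n * d)
  have := hcon T f last h
  omega

/-- The cut that isolates the collector of `S` together with the output vertices of the latest
newcomers for `S` and the input vertices of those for `P`. -/
theorem DHSScheme.minCut_le_of_isLastFailure (A : DHSScheme n d) {k T : ℕ} {f : ℕ → Fin n}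
    {last : Fin n → ℕ} (h : IsLastFailure T f last) (α β : ℝ≥0∞)
    (S : {S : Finset (Fin n) // S.card = k}) (P : Finset (Fin n)) :
    _root_.minCut (A.capacity (fun l : Fin T => f l) k α β) .source (.collector S) ≤
      ∑ j ∈ P, ((A.seqHelpers f (last j) \ S.1.filter (last · < last j)).card : ℝ≥0∞) * β
        + (S.1 \ P).card * α := by
  classical
  set F : Fin T → Fin n := fun l => f l
  let new : Fin n → StorageNode n T := fun j => .inr ⟨last j, h.lt j⟩
  have hindex : ∀ j, StorageNode.index F (new j) = j := h.index
  have hinj : Function.Injective new := fun i j hij => by rw [← hindex i, hij, hindex]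
  have hactive : ∀ (i : Fin n) (τ : ℕ), last i < τ → StorageNode.IsActive F τ (new i) :=
    fun i τ hi => ⟨hi, fun l hl _ => by
      rw [show F ⟨last i, h.lt i⟩ = i from h.index i]; exact h.ne_of_lt i l hl l.2⟩
  set c := A.capacity F k α β
  let W : Finset (IFGVertex n k T) :=
    insert (.collector S) (P.image (fun j => .inp (new j)) ∪ S.1.image (fun j => .out (new j)))
  have hout : ∀ j ∈ S.1, IFGVertex.out (new j) ∈ W := fun j hj =>
    Finset.mem_insert_of_mem (Finset.mem_union_right _ (Finset.mem_image_of_mem _ hj))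
  have hinp : ∀ j ∈ P, IFGVertex.inp (new j) ∈ W := fun j hj =>
    Finset.mem_insert_of_mem (Finset.mem_union_left _ (Finset.mem_image_of_mem _ hj))
  refine (iInf₂_le Wᶜ ⟨by simp [W], by simp [W]⟩).trans ?_
  rw [compl_compl, Finset.sum_comm]
  -- The finally active nodes are the latest newcomers, whose outputs for `S` all lie in `W`.
  have h0 : ∑ u ∈ Wᶜ, c u (.collector S) = 0 := by
    refine Finset.sum_eq_zero fun u hu => ?_
    rcases u with _ | v | v | S' <;> try rfl
    simp only [c, DHSScheme.capacity]
    refine if_neg fun ⟨hv, hvS⟩ => Finset.mem_compl.1 hu ?_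
    rw [hv.eq_of_index_eq (hactive (StorageNode.index F v) T (h.lt _)) (hindex _).symm]
    exact hout _ hvS
  have h1 : ∀ j ∈ P, ∑ u ∈ Wᶜ, c u (.inp (new j)) ≤
      ((A.seqHelpers f (last j) \ S.1.filter (last · < last j)).card : ℝ≥0∞) * β := by
    intro j _
    let Q := Wᶜ.filter fun u => ∃ v, u = .out v ∧ StorageNode.IsActive F (last j) v ∧
      StorageNode.index F v ∈ A.seqHelpers f (last j)
    have hQ : ∑ u ∈ Wᶜ, c u (.inp (new j)) = Q.card * β := by
      rw [← nsmul_eq_mul, ← Finset.sum_const, Finset.sum_filter]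
      refine Finset.sum_congr rfl fun u _ => ?_
      rcases u with _ | v | v | S' <;> simp [c, new, DHSScheme.capacity]
      rfl
    rw [hQ]
    gcongr
    refine Finset.card_le_card_of_injOn
      -- The default `j` is never reached, since `Q` contains only output vertices.
      (fun u => match u with | .out v => StorageNode.index F v | _ => j) ?_ ?_
    · intro u hu
      obtain ⟨huW, v, rfl, hv, hvH⟩ := Finset.mem_filter.1 hu
      refine Finset.mem_coe.2 (Finset.mem_sdiff.2 ⟨hvH, fun hvS => Finset.mem_compl.1 huW ?_⟩)
      obtain ⟨hvS, hlt⟩ := Finset.mem_filter.1 hvS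
      rw [hv.eq_of_index_eq (hactive (StorageNode.index F v) _ hlt) (hindex _).symm]
      exact hout _ hvS
    · intro u hu u' hu' huu'
      obtain ⟨-, v, rfl, hv, -⟩ := Finset.mem_filter.1 hu
      obtain ⟨-, v', rfl, hv', -⟩ := Finset.mem_filter.1 hu'
      rw [hv.eq_of_index_eq hv' huu']
  have h2 : ∀ j ∈ S.1, ∑ u ∈ Wᶜ, c u (.out (new j)) ≤ if j ∈ P then 0 else α := by
    intro j _
    have h3 : ∀ u, c u (.out (new j)) = if u = .inp (new j) then α else 0 := by
      intro u
      rcases u with _ | v | v | S' <;> simp [c, DHSScheme.capacity]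
    simp only [h3, Finset.sum_ite_eq']
    split_ifs with h4 h5
    · exact absurd (hinp j h5) (Finset.mem_compl.1 h4)
    all_goals simp
  rw [Finset.sum_insert (by simp), h0, zero_add, Finset.sum_union (by
      rw [Finset.disjoint_left]; simp),
    Finset.sum_image fun i _ j _ hij => hinj (IFGVertex.inp.inj hij),
    Finset.sum_image fun i _ j _ hij => hinj (IFGVertex.out.inj hij)]
  refine add_le_add (Finset.sum_le_sum h1) ((Finset.sum_le_sum h2).trans ?_)
  simp [Finset.sum_ite, Finset.filter_notMem_eq_sdiff]

theorem DHSScheme.exists_minCut_le (A : DHSScheme n d) (hn : 2 ≤ n) :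
    ∃ (T : ℕ) (F : Fin T → Fin n) (S : {S : Finset (Fin n) // S.card = n - 1}) (N : ℕ),
      2 * (N + d) ≤ n * d ∧ ∀ α β : ℝ≥0∞,
        _root_.minCut (A.capacity F (n - 1) α β) .source (.collector S) ≤ α + N * β ∧
        _root_.minCut (A.capacity F (n - 1) α β) .source (.collector S) ≤ (N + d : ℕ) * β := by
  have : Nonempty (Fin n) := ⟨⟨0, by omega⟩⟩
  obtain ⟨T, f, last, h, hE⟩ := A.exists_many_arcs (by omega)
  obtain ⟨w, hw⟩ := exists_small_degree (A.Arc f last) (A.not_arc_self f last)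
  rw [Fintype.card_fin] at hw
  set S : Finset (Fin n) := Finset.univ.erase w
  have hS : S.card = n - 1 := by simp [S]
  let cost : Fin n → ℕ := fun j => (A.seqHelpers f (last j) \ S.filter (last · < last j)).card
  -- The earliest newcomer has no helper among the others in `S`, so it pays for all `d` helper
  -- edges.
  obtain ⟨j₀, hj₀, hmin⟩ := S.exists_min_image last (Finset.card_pos.1 (by omega))
  have hcost₀ : cost j₀ = d := by
    have : S.filter (last · < last j₀) = ∅ := Finset.filter_eq_empty_iff.2 fun {i} hi =>
      not_lt.2 (hmin i hi)
    simp only [cost, this, Finset.sdiff_empty]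
    exact A.card_helpers _ _
  have hcost : ∀ j, cost j + (Finset.univ.filter fun i => i ≠ w ∧ A.Arc f last i j).card = d := by
    intro j
    have : (Finset.univ.filter fun i => i ≠ w ∧ A.Arc f last i j) =
        A.seqHelpers f (last j) ∩ S.filter (last · < last j) := by
      ext i
      rw [Finset.mem_filter]
      simp only [S, DHSScheme.Arc, Finset.mem_filter, Finset.mem_univ, true_and, Finset.mem_inter,
        Finset.mem_erase, and_true]
      tauto
    rw [this, Finset.card_sdiff_add_card_inter]
    exact A.card_helpers _ _
  have hsum : ∑ j ∈ S, cost j + ∑ j ∈ S, (Finset.univ.filter fun i => i ≠ w ∧ A.Arc f last i j).card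
      = (n - 1) * d := by
    rw [← Finset.sum_add_distrib, Finset.sum_congr rfl fun j _ => hcost j, Finset.sum_const, hS,
      smul_eq_mul]
  have hsplit : ∑ j ∈ S, cost j = ∑ j ∈ S.erase j₀, cost j + d := by
    rw [← Finset.sum_erase_add _ _ hj₀, hcost₀]
  refine ⟨T, fun l => f l, ⟨S, hS⟩, ∑ j ∈ S.erase j₀, cost j, ?_, fun α β => ⟨?_, ?_⟩⟩
  · rw [← hsplit]
    obtain ⟨q, rfl⟩ : ∃ q, n = q + 2 := ⟨n - 2, by omega⟩
    generalize ∑ j ∈ S, cost j = N at *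
    generalize ∑ j ∈ S, (Finset.univ.filter fun i => i ≠ w ∧ A.Arc f last i j).card = E' at *
    generalize ∑ j, (Finset.univ.filter fun i => A.Arc f last i j).card = E at *
    -- Omitting `w` leaves `E' ≥ (1 - 2/n) E`, and `E ≥ n d / 2`; hence the cost `(n - 1) d - E'` is
    -- at most `n d / 2`.
    have h1 : q * d ≤ 2 * E' := by
      have h3 : q * E ≤ (q + 2) * E' := by linarith [add_mul q 2 E]
      refine le_of_mul_le_mul_left (a := q + 2) ?_ (Nat.succ_pos _)
      linarith [Nat.mul_le_mul_left q hE, Nat.mul_le_mul_left 2 h3]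
    have h2 : q + 2 - 1 = q + 1 := by omega
    rw [h2] at hsum
    nlinarith
  · refine (A.minCut_le_of_isLastFailure h α β ⟨S, hS⟩ (S.erase j₀)).trans ?_
    have : S \ S.erase j₀ = {j₀} := by simp [Finset.sdiff_erase_self hj₀]
    simp only [this, Finset.card_singleton, Nat.cast_one, one_mul]
    rw [add_comm, ← Finset.sum_mul, Nat.cast_sum]
  · refine (A.minCut_le_of_isLastFailure h α β ⟨S, hS⟩ S).trans ?_
    rw [← hsplit]
    simp [← Finset.sum_mul, cost]

end Upper

/-! ### The family-plus scheme -/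

theorem mem_familyHelpers_iff {m d : ℕ} (hmod : m % (m - d) = 0) (i j : Fin m) :
    j ∈ familyHelpers m d i ↔ (j : ℕ) / (m - d) ≠ (i : ℕ) / (m - d) := by
  have h : m / (m - d) * (m - d) = m := Nat.div_mul_cancel (Nat.dvd_of_mod_eq_zero hmod)
  rw [familyHelpers, if_pos (by rw [h]; exact i.2)]
  simp

theorem mem_map_familyHelpers_iff {d B : ℕ} {m : Fin B → ℕ} (hmod : ∀ b, m b % (m b - d) = 0)
    {V : Type*} (e : V ≃ (b : Fin B) × Fin (m b)) (i j : V) :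
    j ∈ (familyHelpers (m (e i).1) d (e i).2).map
        ((Function.Embedding.sigmaMk (e i).1).trans e.symm.toEmbedding) ↔
      (e j).1 = (e i).1 ∧
        ((e j).2 : ℕ) / (m (e j).1 - d) ≠ ((e i).2 : ℕ) / (m (e i).1 - d) := by
  obtain ⟨p, rfl⟩ := e.symm.surjective i
  obtain ⟨⟨c, y⟩, rfl⟩ := e.symm.surjective j
  rw [e.apply_symm_apply, e.apply_symm_apply, Finset.mem_map]
  obtain ⟨b, x⟩ := p
  constructor
  · rintro ⟨z, hz, h⟩
    obtain ⟨rfl, h⟩ := Sigma.mk.inj (e.symm.injective h)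
    obtain rfl := eq_of_heq h
    exact ⟨rfl, (mem_familyHelpers_iff (hmod _) _ _).1 hz⟩
  · rintro ⟨h, hne⟩
    obtain rfl : c = b := h
    exact ⟨y, (mem_familyHelpers_iff (hmod _) _ _).2 hne, rfl⟩

theorem le_minCutValues_familyPlus {n d B : ℕ} (hn : 2 ≤ n) {m : Fin B → ℕ} (hm : ∀ b, d < m b)
    (hmod : ∀ b, m b % (m b - d) = 0) (e : Fin n ≃ (b : Fin B) × Fin (m b)) (β : ℝ≥0∞) {c : ℝ≥0∞}
    (hc : c ∈ (familyPlus m hm e).minCutValues (n - 1) (d * β) β) :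
    ((n * d : ℕ) : ℝ≥0∞) * β ≤ 2 * c := by
  obtain ⟨T, F, S, rfl⟩ := hc
  refine DHSScheme.le_minCut_stationary _ _ (fun i j hj => ?_) hn F β S
  rw [mem_map_familyHelpers_iff hmod] at hj ⊢
  exact ⟨hj.1.symm, hj.2.symm⟩

theorem DHSScheme.minCut_le {n d k T : ℕ} (A : DHSScheme n d) (F : Fin T → Fin n) (α β : ℝ≥0∞)
    (S : {S : Finset (Fin n) // S.card = k}) :
    A.minCut k α β ≤ _root_.minCut (A.capacity F k α β) .source (.collector S) :=
  sInf_le ⟨T, F, S, rfl⟩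

theorem DHSScheme.minCut_mono {n d : ℕ} (A : DHSScheme n d) (k : ℕ) {α α' β β' : ℝ≥0∞}
    (hα : α ≤ α') (hβ : β ≤ β') : A.minCut k α β ≤ A.minCut k α' β' := by
  refine le_sInf ?_
  rintro _ ⟨T, F, S, rfl⟩
  refine (DHSScheme.minCut_le _ F _ _ S).trans (iInf₂_mono fun U _ => Finset.sum_le_sum fun u _ =>
    Finset.sum_le_sum fun v _ => ?_)
  rcases u with _ | u | u | S₁ <;> rcases v with _ | (v | v) | v | S₂ <;>
    simp only [DHSScheme.capacity, le_refl] <;> split_ifs <;> simp [hα, hβ]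

theorem mainTheorem3 (n k d : ℕ) (hn : 2 ≤ n) (hk : k = n - 1) (hd : 1 ≤ d)
    (B : ℕ) (m : Fin B → ℕ) (hm : ∀ b, d < m b) (hmod : ∀ b, m b % (m b - d) = 0)
    (e : Fin n ≃ (b : Fin B) × Fin (m b)) :
    (∀ α β : ℝ≥0, α = d * β →
      IsLeast ((familyPlus m hm e).minCutValues k α β) ((n * α / 2 : ℝ≥0) : ℝ≥0∞) ∧
      (familyPlus m hm e).minCut k α β = ((n * α / 2 : ℝ≥0) : ℝ≥0∞) ∧
      ∀ A : DHSScheme n d, A.minCut k α β ≤ ((n * α / 2 : ℝ≥0) : ℝ≥0∞)) ∧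
    (∀ M : ℝ≥0,
      (familyPlus m hm e).IsMBRPoint k M ((2 * M / n : ℝ≥0) : ℝ≥0∞)
        ((2 * M / (n * d) : ℝ≥0) : ℝ≥0∞) ∧
      ∀ (A : DHSScheme n d) (a b : ℝ≥0∞), M ≤ A.minCut k a b →
        ((2 * M / (n * d) : ℝ≥0) : ℝ≥0∞) ≤ b) := by
  subst hk
  have hn0 : (n : ℝ≥0) ≠ 0 := by exact_mod_cast (by omega : n ≠ 0)
  have hd0 : (d : ℝ≥0) ≠ 0 := by exact_mod_cast (by omega : d ≠ 0)
  have hlower : ∀ (α β : ℝ≥0), α = d * β →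
      ∀ c ∈ (familyPlus m hm e).minCutValues (n - 1) α β, ((n * α / 2 : ℝ≥0) : ℝ≥0∞) ≤ c := by
    rintro α β rfl c hc
    rw [ENNReal.coe_mul, ENNReal.coe_natCast] at hc
    have h := le_minCutValues_familyPlus hn hm hmod e β hc
    rw [ENNReal.coe_div two_ne_zero]
    refine ENNReal.div_le_of_le_mul' ?_
    push_cast at h ⊢
    rwa [← mul_assoc]
  have hcoe : ∀ (N : ℕ) (β : ℝ≥0), 2 * N ≤ n * d →
      ((N : ℕ) : ℝ≥0∞) * β ≤ ((n * (d * β) / 2 : ℝ≥0) : ℝ≥0∞) := by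
    intro N β h
    rw [← ENNReal.coe_natCast, ← ENNReal.coe_mul, ENNReal.coe_le_coe, le_div_iff₀ two_pos]
    have : (2 * N : ℝ≥0) ≤ n * d := by exact_mod_cast h
    calc (N * β * 2 : ℝ≥0) = 2 * N * β := by ring
      _ ≤ n * d * β := by gcongr
      _ = _ := by ring
  have hupper : ∀ (A : DHSScheme n d) (a : ℝ≥0∞) (β : ℝ≥0),
      A.minCut (n - 1) a β ≤ ((n * (d * β) / 2 : ℝ≥0) : ℝ≥0∞) := by
    intro A a β
    -- The second bound does not involve the storage capacity, so `a = ⊤` is covered.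
    obtain ⟨T, F, S, N, hN, h⟩ := A.exists_minCut_le hn
    exact (DHSScheme.minCut_le _ F _ _ S).trans ((h a β).2.trans (hcoe _ _ hN))
  have hbound : ∀ (M : ℝ≥0) (A : DHSScheme n d) (a b : ℝ≥0∞), M ≤ A.minCut (n - 1) a b →
      ((2 * M / (n * d) : ℝ≥0) : ℝ≥0∞) ≤ b := by
    intro M A a b h
    induction b using ENNReal.recTopCoe with
    | top => exact le_top
    | coe b =>
      have h' := ENNReal.coe_le_coe.1 (h.trans (hupper A a b))
      rw [le_div_iff₀ two_pos] at h'
      rw [ENNReal.coe_le_coe, div_le_iff₀ (by positivity)]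
      calc 2 * M = M * 2 := mul_comm _ _
        _ ≤ n * (d * b) := h'
        _ = _ := by ring
  have hpoint : ∀ M : ℝ≥0, (M : ℝ≥0∞) ≤ (familyPlus m hm e).minCut (n - 1)
      ((2 * M / n : ℝ≥0) : ℝ≥0∞) ((2 * M / (n * d) : ℝ≥0) : ℝ≥0∞) := by
    intro M
    refine le_sInf fun c hc => (ENNReal.coe_le_coe.2 (le_of_eq ?_)).trans
      (hlower _ _ (by field_simp) c hc)
    field_simp
  refine ⟨?_, fun M => ⟨⟨⟨?_, fun b hb => hbound M _ _ b hb⟩, hpoint M, fun a ha => ?_⟩, hbound M⟩⟩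
  · rintro α β rfl
    have hleast : IsLeast ((familyPlus m hm e).minCutValues (n - 1) ↑(d * β) β)
        ((n * (d * β) / 2 : ℝ≥0) : ℝ≥0∞) := by
      refine ⟨?_, fun c hc => hlower _ _ rfl c hc⟩
      obtain ⟨T, F, S, N, hN, h⟩ := (familyPlus m hm e).exists_minCut_le hn
      have hmem : _ ∈ (familyPlus m hm e).minCutValues (n - 1) ↑(d * β) β := ⟨T, F, S, rfl⟩
      rwa [le_antisymm ((h _ _).2.trans (hcoe _ _ hN)) (hlower _ _ rfl _ hmem)] at hmem
    exact ⟨hleast, hleast.csInf_eq, fun A => hupper A _ _⟩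
  · exact (hpoint M).trans (DHSScheme.minCut_mono _ _ le_top le_rfl)
  -- The first bound gives `M ≤ a + N β`, while `(N + d) β ≤ n d β / 2 = M`; together they force `a
  -- ≥ d β`.
  · obtain ⟨T, F, S, N, hN, h⟩ := (familyPlus m hm e).exists_minCut_le hn
    induction a using ENNReal.recTopCoe with
    | top => exact le_top
    | coe a =>
      have h1 : (M : ℝ≥0∞) ≤ _ := le_trans ha ((DHSScheme.minCut_le _ F _ _ S).trans (h _ _).1)
      rw [← ENNReal.coe_natCast, ← ENNReal.coe_mul, ← ENNReal.coe_add, ENNReal.coe_le_coe] at h1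
      rw [ENNReal.coe_le_coe]
      set β := 2 * M / (n * d)
      have hα : 2 * M / n = d * β := by simp only [β]; field_simp
      have hM : 2 * M = n * d * β := by simp only [β]; field_simp
      have hN' : (2 * (N + d) : ℝ≥0) ≤ n * d := by exact_mod_cast hN
      have h2 : 2 * (N + d) * β ≤ 2 * M := hM ▸ mul_le_mul_left hN' β
      rw [hα]
      rw [← NNReal.coe_le_coe] at h1 h2 ⊢
      push_cast at h1 h2 ⊢
      linarith
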